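/- Let $U$ be an optimal conditional decompressor, that is, a partial computable function $(p,y)\mapsto U(p,y)$ of two binary strings with binary string values such that for every partial computable $V$ there is a constant $d$ with the following property: whenever $V(p,y)=x$, there is $q$ with $U(q,y)=x$ and $|q|\le |p|+d$. Let $K(x|y)=\min\{|p| : U(p,y)=x\}$ be plain conditional Kolmogorov complexity, let $K(x)=K(x|\Lambda)$ where $\Lambda$ is the empty string, let $K(a,b)=K(\langle a,b\rangle)$ where $\langle a,b\rangle=1^{|a|}0ab$ is the standard computable encoding of pairs of strings by strings, and let $I(a:b)=K(a)+K(b)-K(a,b)$ be the mutual information. Put $$M(a,b)=\log_2 K(a)+\log_2 K(b)+I(a:b),$$ where $\log_2 0$ is read as $0$. Theorem. There is a constant $c$ (depending only on $U$) such that for every two binary strings $a,b$ and all integers $\alpha,\beta$ with $0\le\alpha\le K(a)$, $0\le\beta\le K(b)$ and - $\alpha\ge c\,M(a,b)$ and $\beta\ge c\,M(a,b)$, - $\alpha\le K(a)-c\,M(a,b)$, - $\beta\le K(b)-c\,M(a,b)$, there exists a binary string $y$ such that $|K(a|y)-\alpha|\le c$ and $|K(b|y)-\beta|\le c$. -/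

import Mathlib

/-- A (conditional) decompressor: a partial function that takes a program `p` and a condition `y`,
both binary strings, and may output a binary string. -/
abbrev Decompressor : Type := List Bool → List Bool →. List Bool

/-- `U` is an optimal conditional decompressor: it is partial computable, and for every partial
computable decompressor `V` there is a constant `d` such that whatever `V` produces from a program
`p` under a condition `y`, `U` produces under the same condition from some program that is
longer than `p` by at most `d`. -/
def IsOptimal (U : Decompressor) : Prop :=
  Partrec₂ U ∧
    ∀ V : Decompressor, Partrec₂ V →
      ∃ d : ℕ, ∀ p y x : List Bool, x ∈ V p y →
        ∃ q : List Bool, x ∈ U q y ∧ q.length ≤ p.length + d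

/-- Plain conditional complexity `K(x|y)` with respect to `U`: the minimal length of a program
from which `U` produces `x` under the condition `y`. (If `U` is optimal such a program exists,
see `IsOptimal.exists_program`.) -/
noncomputable def condK (U : Decompressor) (x y : List Bool) : ℕ :=
  sInf {n : ℕ | ∃ p : List Bool, x ∈ U p y ∧ p.length = n}

/-- Plain complexity `K(x)`: the condition is the empty string. -/
noncomputable def plainK (U : Decompressor) (x : List Bool) : ℕ :=
  condK U x []

/-- The standard computable injective encoding `1^{|x|} 0 x y` of the pair `(x, y)` by one
binary string. -/
def pairStr (x y : List Bool) : List Bool :=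
  List.replicate x.length true ++ false :: (x ++ y)

/-- Mutual information `I(a : b) = K(a) + K(b) - K(a, b)`; it is an integer that may be
(slightly) negative. -/
noncomputable def mutualInfo (U : Decompressor) (a b : List Bool) : ℤ :=
  (plainK U a : ℤ) + (plainK U b : ℤ) - (plainK U (pairStr a b) : ℤ)

/-- The margin `log K(a) + log K(b) + I(a : b)`, with binary logarithms (`log 0` is `0`). -/
noncomputable def margin (U : Decompressor) (a b : List Bool) : ℝ :=
  Real.logb 2 (plainK U a) + Real.logb 2 (plainK U b) + (mutualInfo U a b : ℝ)

/-- With an optimal decompressor every string has a program under every condition, so the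
minimum in `condK` is over a nonempty set. -/
theorem IsOptimal.exists_program {U : Decompressor} (hU : IsOptimal U) (x y : List Bool) :
    ∃ p : List Bool, x ∈ U p y := by
  obtain ⟨d, hd⟩ := hU.2 (fun p _ => Part.some p) (Computable.fst : Computable _).partrec
  obtain ⟨q, hq, -⟩ := hd x y x (Part.mem_some x)
  exact ⟨q, hq⟩

/-- The pair encoding is injective. -/
theorem pairStr_injective {x y x' y' : List Bool} (h : pairStr x y = pairStr x' y') :
    x = x' ∧ y = y' := by
  have key : ∀ (n m : ℕ) (s t : List Bool),
      List.replicate n true ++ false :: s = List.replicate m true ++ false :: t →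
        n = m ∧ s = t := by
    intro n
    induction n with
    | zero =>
      intro m s t h
      cases m <;> simp_all [List.replicate_succ]
    | succ k ih =>
      intro m s t h
      cases m with
      | zero => simp [List.replicate_succ] at h
      | succ m =>
        simp only [List.replicate_succ, List.cons_append, List.cons.injEq, true_and] at h
        obtain ⟨h1, h2⟩ := ih m s t h
        exact ⟨by omega, h2⟩
  obtain ⟨h1, h2⟩ := key _ _ _ _ h
  exact List.append_inj h2 h1

/-- Optimal decompressors exist: run the machine with number `n` on the program `p` when the input
is `1^n 0 p`. -/
theorem exists_isOptimal : ∃ U : Decompressor, IsOptimal U := by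
  let i : List Bool → ℕ := fun s => s.findIdx (fun b => !b)
  have hi : Computable i := by
    refine (Primrec.list_findIdx Primrec.id ?_).to_comp
    exact Primrec.not.comp Primrec.snd
  have hcut : ∀ (n : ℕ) (p : List Bool), i (List.replicate n true ++ false :: p) = n ∧
      List.tail ((List.tail)^[n] (List.replicate n true ++ false :: p)) = p := by
    intro n p
    induction n with
    | zero => simp [i, List.findIdx_cons]
    | succ k ih =>
      constructor
      · have := ih.1
        simp only [i] at this ⊢
        simp [List.replicate_succ, List.findIdx_cons, this]
      · simpa [List.replicate_succ] using ih.2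
  let r : List Bool → List Bool := fun s => List.tail ((List.tail)^[i s] s)
  have hr : Computable r := by
    have h1 : Computable (fun s : List Bool => (List.tail)^[i s] s) :=
      (Primrec.nat_iterate (f := i) (g := id) (h := fun _ l => List.tail l)
        (Primrec.list_findIdx Primrec.id (Primrec.not.comp Primrec.snd).to₂)
        Primrec.id (Primrec.list_tail.comp Primrec.snd).to₂).to_comp
    exact Primrec.list_tail.to_comp.comp h1
  let U : Decompressor := fun s y =>
    ((Nat.Partrec.Code.eval (Denumerable.ofNat Nat.Partrec.Code (i s))
      (Encodable.encode (r s, y))).bind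
        fun k => ((Encodable.decode k : Option (List Bool)) : Part (List Bool)))
  refine ⟨U, ?_, ?_⟩
  · have h1 : Partrec (fun q : List Bool × List Bool =>
        Nat.Partrec.Code.eval (Denumerable.ofNat Nat.Partrec.Code (i q.1))
          (Encodable.encode (r q.1, q.2))) :=
      Nat.Partrec.Code.eval_part.comp
        ((Computable.ofNat Nat.Partrec.Code).comp (hi.comp Computable.fst))
        (Computable.encode.comp (Computable.pair (hr.comp Computable.fst) Computable.snd))
    exact h1.bind (Computable.ofOption (Computable.decode.comp Computable.snd))
  · intro V hV
    obtain ⟨c, hc⟩ := Nat.Partrec.Code.exists_code.1 hV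
    refine ⟨Encodable.encode c + 1, fun p y x hx => ?_⟩
    refine ⟨List.replicate (Encodable.encode c) true ++ false :: p, ?_, by simp; omega⟩
    have h1 := (hcut (Encodable.encode c) p).1
    have h2 := (hcut (Encodable.encode c) p).2
    simp only [U, r, h1, h2, Denumerable.ofNat_encode, hc]
    simpa [Encodable.encodek] using hx

/-!
Let `p` and `q` be shortest programs for `a` and `b`. The conditions to be tried are the codes of
the pairs `(p.take i, q.take j)`, where `(i, j)` runs over a rectangular grid. Passing from a vertex
of the grid to a neighbour adds or removes one bit, so `K(a|·)` and `K(b|·)` change by at most a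
constant (`IsOptimal.exists_abs_condK_concat_le`).

On the boundary of the grid these functions are under control. If `i = |p|`, the condition
determines `a`, so `K(a|·)` is bounded by a constant. If `i = 0`, a program for `a` under the
condition `q.take j` together with `q` describes the pair `(a, b)`, hence `K(a|·)` is at least
`K(a, b) - K(b)`, that is `K(a) - I(a : b)`, up to a logarithmic term
(`IsOptimal.exists_plainK_le_condK_prefix`). The same holds for `b` on the other two sides. So the
image of the boundary winds around the point `(α, β)`, and the discrete Poincaré–Miranda theorem
`exists_near_of_boundary_signs`, proved by a parity count as in Sperner's lemma, gives a vertex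
whose image is within a constant distance of `(α, β)`.

The error terms have to be absorbed by a multiple of the margin, which contains the possibly
negative term `I(a : b)`. For this the margin must bound the logarithms of both complexities, up to
a constant (`IsOptimal.exists_logb_plainK_le_margin`); to that end pairs are described with an
overhead of `3 / 2` times the logarithm of the smaller complexity, a factor below `2`
(`splitPrefix`). If the margin is below `1`, both complexities are bounded by a constant and the
empty condition suffices.
-/

/-! ### A discrete Poincaré–Miranda theorem -/

/-- Indicator that a segment with end values `u` and `v` crosses the level `β` in the second
coordinate while both ends are at or above the level `α` in the first one, that is, that its ends
carry the labels "`α ≤ A`, `β ≤ B`" and "`α ≤ A`, `B < β`". It takes values in `ZMod 2` because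
only the parity of the number of such segments matters. -/
def crossing (α β : ℤ) (u v : ℤ × ℤ) : ZMod 2 :=
  if α ≤ u.1 ∧ α ≤ v.1 ∧ (β ≤ u.2 ↔ v.2 < β) then 1 else 0

/-- A triangle of diameter at most `D` with a vertex farther than `D` from `(α, β)` has an even
number of crossing sides: an odd number would force all three labels of Sperner's lemma (the third
one is "`A < α`") on its vertices, and then every vertex is near `(α, β)`. -/
theorem crossing_triangle {α β D : ℤ} {u v w : ℤ × ℤ}
    (huv₁ : |u.1 - v.1| ≤ D) (hvw₁ : |v.1 - w.1| ≤ D) (huw₁ : |u.1 - w.1| ≤ D)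
    (huv₂ : |u.2 - v.2| ≤ D) (hvw₂ : |v.2 - w.2| ≤ D) (huw₂ : |u.2 - w.2| ≤ D)
    (hw : |w.1 - α| ≤ D → D < |w.2 - β|) :
    crossing α β u v + crossing α β v w + crossing α β u w = 0 := by
  simp only [abs_le] at huv₁ hvw₁ huw₁ huv₂ hvw₂ huw₂
  simp only [abs_le, lt_abs, and_imp] at hw
  by_cases a1 : α ≤ u.1 <;> by_cases a2 : α ≤ v.1 <;> by_cases a3 : α ≤ w.1 <;>
  by_cases b1 : β ≤ u.2 <;> by_cases b2 : β ≤ v.2 <;> by_cases b3 : β ≤ w.2 <;>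
  simp [crossing, a1, a2, a3, b1, b2, b3, ← not_le] <;> first | rfl | omega

/-- Discrete Poincaré–Miranda theorem: if `A` and `B` change by at most `L` along each edge of a
rectangular grid, `A` goes from at least `α` on the left side to below `α` on the right side, and
`B` goes from at least `β` on the bottom side to below `β` on the top side, then at some vertex
both values are within `2 * L` of `α` and `β`. -/
theorem exists_near_of_boundary_signs {A B : ℕ → ℕ → ℤ} {m n : ℕ} {α β L : ℤ}
    (hA₁ : ∀ i j, i < m → j ≤ n → |A (i + 1) j - A i j| ≤ L)
    (hA₂ : ∀ i j, i ≤ m → j < n → |A i (j + 1) - A i j| ≤ L)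
    (hB₁ : ∀ i j, i < m → j ≤ n → |B (i + 1) j - B i j| ≤ L)
    (hB₂ : ∀ i j, i ≤ m → j < n → |B i (j + 1) - B i j| ≤ L)
    (hleft : ∀ j ≤ n, α ≤ A 0 j) (hright : ∀ j ≤ n, A m j < α)
    (hbot : ∀ i ≤ m, β ≤ B i 0) (htop : ∀ i ≤ m, B i n < β) :
    ∃ i ≤ m, ∃ j ≤ n, |A i j - α| ≤ 2 * L ∧ |B i j - β| ≤ 2 * L := by
  by_contra! hno
  let e : ℕ → ℕ → ℕ → ℕ → ZMod 2 := fun i j k l => crossing α β (A i j, B i j) (A k l, B k l)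
  -- Each unit square is cut into two triangles by a diagonal, which is counted twice.
  have hsq : ∀ i j, i < m → j < n →
      e i j i (j + 1) + e i (j + 1) (i + 1) (j + 1) + e (i + 1) j (i + 1) (j + 1)
        + e i j (i + 1) j = 0 := by
    intro i j hi hj
    have h1 := abs_le.1 (hA₁ i j hi hj.le)
    have h2 := abs_le.1 (hA₁ i (j + 1) hi hj)
    have h3 := abs_le.1 (hA₂ i j hi.le hj)
    have h4 := abs_le.1 (hA₂ (i + 1) j hi hj)
    have h5 := abs_le.1 (hB₁ i j hi hj.le)
    have h6 := abs_le.1 (hB₁ i (j + 1) hi hj)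
    have h7 := abs_le.1 (hB₂ i j hi.le hj)
    have h8 := abs_le.1 (hB₂ (i + 1) j hi hj)
    have hfar := hno (i + 1) hi (j + 1) hj
    have t1 : e i j i (j + 1) + e i (j + 1) (i + 1) (j + 1) + e i j (i + 1) (j + 1) = 0 := by
      refine crossing_triangle (D := 2 * L) (u := (A i j, B i j)) (v := (A i (j + 1), B i (j + 1)))
        (w := (A (i + 1) (j + 1), B (i + 1) (j + 1))) ?_ ?_ ?_ ?_ ?_ ?_ hfar <;>
        (rw [abs_le]; constructor <;> dsimp only <;> omega)
    have t2 : e i j (i + 1) j + e (i + 1) j (i + 1) (j + 1) + e i j (i + 1) (j + 1) = 0 := by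
      refine crossing_triangle (D := 2 * L) (u := (A i j, B i j)) (v := (A (i + 1) j, B (i + 1) j))
        (w := (A (i + 1) (j + 1), B (i + 1) (j + 1))) ?_ ?_ ?_ ?_ ?_ ?_ hfar <;>
        (rw [abs_le]; constructor <;> dsimp only <;> omega)
    have := CharTwo.add_self_eq_zero (e i j (i + 1) (j + 1))
    linear_combination t1 + t2 - this
  -- The parity of crossings along a column does not depend on the column, since the bottom and
  -- the top side contain no crossing.
  have hconst : ∀ i ≤ m, ∑ j ∈ Finset.range n, e i j i (j + 1)
      = ∑ j ∈ Finset.range n, e 0 j 0 (j + 1) := by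
    intro i
    induction i with
    | zero => intro _; rfl
    | succ i ih =>
      intro hi
      rw [← ih (by omega)]
      have hz : e i 0 (i + 1) 0 = 0 ∧ e i n (i + 1) n = 0 := by
        have := hbot i (by omega)
        have := hbot (i + 1) hi
        have := htop i (by omega)
        have := htop (i + 1) hi
        constructor <;> apply if_neg <;> dsimp only <;> omega
      have := Finset.sum_range_sub (fun j => e i j (i + 1) j) n
      rw [hz.1, hz.2, sub_zero] at this
      rw [← sub_eq_zero, ← Finset.sum_sub_distrib, ← this]
      refine Finset.sum_congr rfl fun j hj => ?_
      have := hsq i j hi (Finset.mem_range.1 hj)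
      simp only [CharTwo.sub_eq_add]
      linear_combination this - (e i (j + 1) (i + 1) (j + 1) + e i j (i + 1) j)
        * CharTwo.two_eq_zero (R := ZMod 2)
  -- On the left side `B` passes from `β ≤ B` to `B < β`, so the number of crossings is odd.
  have hone : ∑ j ∈ Finset.range n, e 0 j 0 (j + 1) = 1 := by
    let g : ℕ → ZMod 2 := fun j => if β ≤ B 0 j then 0 else 1
    have h := Finset.sum_range_sub g n
    have g0 : g 0 = 0 := if_pos (hbot 0 (Nat.zero_le _))
    have gn : g n = 1 := if_neg (not_le.2 (htop 0 (Nat.zero_le _)))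
    rw [g0, gn, sub_zero] at h
    rw [← h]
    refine Finset.sum_congr rfl fun j hj => ?_
    have hj := Finset.mem_range.1 hj
    have h1 := hleft j hj.le
    have h2 := hleft (j + 1) hj
    simp only [e, crossing, g, h1, h2, true_and, CharTwo.sub_eq_add]
    by_cases b1 : β ≤ B 0 j <;> by_cases b2 : β ≤ B 0 (j + 1) <;>
      simp [b1, b2, ← not_le]
    rfl
  have hzero : ∑ j ∈ Finset.range n, e m j m (j + 1) = 0 := by
    refine Finset.sum_eq_zero fun j hj => if_neg ?_
    have := hright j (Finset.mem_range.1 hj).le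
    dsimp only
    omega
  rw [← hconst m le_rfl, hzero] at hone
  exact zero_ne_one hone

/-! ### A self-delimiting code for strings -/

/-- The number whose binary notation, most significant bit first, is the given word. -/
def binValue (w : List Bool) : ℕ :=
  w.foldl (fun s b => 2 * s + (bif b then 1 else 0)) 0

theorem exists_binValue_eq (k n : ℕ) (h : n < 2 ^ k) :
    ∃ w : List Bool, w.length = k ∧ binValue w = n := by
  induction k generalizing n with
  | zero => exact ⟨[], rfl, by simp at h; simp [binValue, h]⟩
  | succ k ih =>
    obtain ⟨w, hw, hv⟩ := ih (n / 2) (by rw [pow_succ] at h; omega)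
    refine ⟨w ++ [decide (n % 2 = 1)], by simp [hw], ?_⟩
    have : binValue (w ++ [decide (n % 2 = 1)])
        = 2 * binValue w + (bif decide (n % 2 = 1) then 1 else 0) := by
      simp [binValue]
    rw [this, hv]
    rcases Nat.mod_two_eq_zero_or_one n with h2 | h2 <;> simp [h2] <;> omega

theorem primrec_binValue : Primrec binValue := by
  refine Primrec.list_foldl (h := fun _ q => 2 * q.1 + (bif q.2 then 1 else 0))
    Primrec.id (Primrec.const 0) ?_
  exact Primrec.nat_add.comp
    (Primrec.nat_mul.comp (Primrec.const 2) (Primrec.fst.comp Primrec.snd))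
    (Primrec.cond (Primrec.snd.comp Primrec.snd) (Primrec.const 1) (Primrec.const 0))

/-- Splits a string of the form `1^m 0 w u r`, where `w` has length `2 * m` and is the binary
notation of the length of `u`, into `u` and `r`. The words `w` have even length so that the
overhead is about `3 / 2` (and not `2`) times the logarithm of the length of `u`. -/
def splitPrefix (s : List Bool) : List Bool × List Bool :=
  let i := s.findIdx (fun b => !b)
  let t := (s.drop (i + 1)).drop (2 * i)
  let n := binValue ((s.drop (i + 1)).take (2 * i))
  (t.take n, t.drop n)

theorem computable_splitPrefix : Computable splitPrefix := by
  have hi : Primrec fun s : List Bool => s.findIdx (fun b => !b) :=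
    Primrec.list_findIdx Primrec.id (Primrec.not.comp Primrec.snd).to₂
  have hd : Primrec fun s : List Bool => s.drop (s.findIdx (fun b => !b) + 1) :=
    Primrec.list_drop.comp (Primrec.succ.comp hi) Primrec.id
  have h2 : Primrec fun s : List Bool => 2 * s.findIdx (fun b => !b) :=
    Primrec.nat_mul.comp (Primrec.const 2) hi
  have ht := Primrec.list_drop.comp h2 hd
  have hn := primrec_binValue.comp (Primrec.list_take.comp h2 hd)
  exact (Primrec.pair (Primrec.list_take.comp hn ht) (Primrec.list_drop.comp hn ht)).to_comp

theorem exists_splitPrefix_eq (u : List Bool) :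
    ∃ s : List Bool, (∀ r, splitPrefix (s ++ r) = (u, r)) ∧
      (s.length : ℝ) ≤ u.length + 3 / 2 * Real.logb 2 u.length + 4 := by
  obtain ⟨m, hm⟩ : ∃ m, m = Nat.log 4 u.length + 1 := ⟨_, rfl⟩
  have hlt : u.length < 2 ^ (2 * m) := by
    rw [pow_mul, hm]; exact Nat.lt_pow_succ_log_self (by norm_num) _
  obtain ⟨w, hw, hv⟩ := exists_binValue_eq _ _ hlt
  refine ⟨List.replicate m true ++ false :: (w ++ u), fun r => ?_, ?_⟩
  · have hi : (List.replicate m true ++ false :: (w ++ u) ++ r).findIdx (fun b => !b) = m := by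
      clear hm hlt hw
      induction m with
      | zero => simp [List.findIdx_cons]
      | succ k ih => simp_all [List.replicate_succ, List.findIdx_cons]
    have hd : (List.replicate m true ++ false :: (w ++ u) ++ r).drop (m + 1) = w ++ (u ++ r) := by
      rw [List.append_assoc, List.drop_append]
      simp
    simp only [splitPrefix, hi, hd, ← hw, List.take_left, List.drop_left, hv]
  · have hlog : (Nat.log 4 u.length : ℝ) ≤ 1 / 2 * Real.logb 2 u.length := by
      rcases Nat.eq_zero_or_pos u.length with h0 | h0
      · simp [h0]
      · have h1 : (4 : ℝ) ^ (Nat.log 4 u.length) ≤ u.length := by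
          exact_mod_cast Nat.pow_log_le_self 4 h0.ne'
        have h2 : (2 : ℝ) ^ (((2 * Nat.log 4 u.length : ℕ)) : ℝ) ≤ u.length := by
          rw [Real.rpow_natCast, pow_mul]; norm_num; exact h1
        have h3 := (Real.le_logb_iff_rpow_le (b := 2) one_lt_two (by exact_mod_cast h0)).2 h2
        push_cast at h3
        linarith
    simp only [List.length_append, List.length_replicate, List.length_cons, hw, hm]
    push_cast
    linarith

/-! ### Pairs of strings as conditions -/

/-- A string that encodes a pair of strings: the number of the pair in unary notation. Its length
is irrelevant, because it serves as a condition only. -/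
def condCode (z : List Bool × List Bool) : List Bool :=
  List.replicate (Encodable.encode z) true

/-- The pair encoded by a string, `([], [])` if there is none. -/
def condDecode (y : List Bool) : List Bool × List Bool :=
  (Encodable.decode y.length).getD ([], [])

theorem condDecode_condCode (z : List Bool × List Bool) : condDecode (condCode z) = z := by
  simp [condDecode, condCode, -Encodable.encode_prod_val]

theorem computable_condDecode : Computable condDecode :=
  (Primrec.option_getD.comp (Primrec.decode.comp Primrec.list_length)
    (Primrec.const ([], []))).to_comp

theorem computable_condCode : Computable condCode := by
  have h : Primrec fun z : List Bool × List Bool =>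
      (fun l => true :: l)^[Encodable.encode z] ([] : List Bool) :=
    Primrec.nat_iterate (h := fun _ l => true :: l) Primrec.encode (Primrec.const [])
      (Primrec.list_cons.comp (Primrec.const true) Primrec.snd)
  refine h.to_comp.of_eq fun z => ?_
  simp only [condCode]
  induction Encodable.encode z with
  | zero => rfl
  | succ n ih => rw [Function.iterate_succ_apply', ih, List.replicate_succ]

theorem computable_pairStr : Computable₂ pairStr := by
  have h : Primrec fun z : List Bool × List Bool =>
      (fun l => true :: l)^[z.1.length] (false :: (z.1 ++ z.2)) :=
    Primrec.nat_iterate (h := fun _ l => true :: l) (Primrec.list_length.comp Primrec.fst)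
      (Primrec.list_cons.comp (Primrec.const false) Primrec.list_append)
      (Primrec.list_cons.comp (Primrec.const true) Primrec.snd)
  refine h.to_comp.of_eq fun z => ?_
  simp only [pairStr]
  induction z.1.length with
  | zero => rfl
  | succ n ih => rw [Function.iterate_succ_apply', ih, List.replicate_succ, List.cons_append]

/-! ### Upper bounds for complexity -/

section Complexity

variable {U : Decompressor}

theorem condK_le_length {p x y : List Bool} (h : x ∈ U p y) : condK U x y ≤ p.length :=
  Nat.sInf_le ⟨p, h, rfl⟩

theorem IsOptimal.exists_shortest (hU : IsOptimal U) (x y : List Bool) :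
    ∃ p : List Bool, x ∈ U p y ∧ p.length = condK U x y := by
  obtain ⟨p, hp⟩ := hU.exists_program x y
  exact Nat.sInf_mem (s := {n : ℕ | ∃ p : List Bool, x ∈ U p y ∧ p.length = n}) ⟨_, p, hp, rfl⟩

theorem IsOptimal.exists_condK_le (hU : IsOptimal U) {V : Decompressor} (hV : Partrec₂ V) :
    ∃ d : ℕ, ∀ p y x : List Bool, x ∈ V p y → condK U x y ≤ p.length + d := by
  obtain ⟨d, hd⟩ := hU.2 V hV
  refine ⟨d, fun p y x h => ?_⟩
  obtain ⟨q, hq, hl⟩ := hd p y x h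
  exact (condK_le_length hq).trans hl

/-- A computable change of the condition loses at most a constant. -/
theorem IsOptimal.exists_condK_le_comp (hU : IsOptimal U) {g : List Bool → List Bool}
    (hg : Computable g) : ∃ d : ℕ, ∀ x y, condK U x y ≤ condK U x (g y) + d := by
  obtain ⟨d, hd⟩ := hU.exists_condK_le (V := fun p y => U p (g y))
    (hU.1.comp Computable.fst (hg.comp Computable.snd))
  refine ⟨d, fun x y => ?_⟩
  obtain ⟨p, hp, hl⟩ := hU.exists_shortest x (g y)
  exact hl ▸ hd p y x hp

theorem IsOptimal.exists_condK_condCode_le (hU : IsOptimal U)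
    {G : List Bool × List Bool → List Bool × List Bool} (hG : Computable G) :
    ∃ d : ℕ, ∀ x z, condK U x (condCode z) ≤ condK U x (condCode (G z)) + d := by
  obtain ⟨d, hd⟩ := hU.exists_condK_le_comp
    (computable_condCode.comp (hG.comp computable_condDecode))
  refine ⟨d, fun x z => ?_⟩
  simpa [condDecode_condCode] using hd x (condCode z)

/-- Complexity is Lipschitz in the condition: adding one bit at the end of a component of a pair
that serves as a condition changes the complexity by at most a constant. -/
theorem IsOptimal.exists_abs_condK_concat_le (hU : IsOptimal U) :
    ∃ L : ℕ, ∀ (x u v : List Bool) (t : Bool),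
      |(condK U x (condCode (u ++ [t], v)) : ℤ) - condK U x (condCode (u, v))| ≤ L ∧
      |(condK U x (condCode (u, v ++ [t])) : ℤ) - condK U x (condCode (u, v))| ≤ L := by
  have hdrop : Computable (List.dropLast : List Bool → List Bool) := by
    refine (Primrec.list_take.comp (Primrec.pred.comp Primrec.list_length)
      Primrec.id).to_comp.of_eq fun l => ?_
    simp [List.dropLast_eq_take]
  have hadd (t : Bool) : Computable (fun l : List Bool => l ++ [t]) :=
    Computable.list_append.comp Computable.id (Computable.const [t])
  obtain ⟨d₁, h₁⟩ := hU.exists_condK_condCode_le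
    ((hdrop.comp Computable.fst).pair Computable.snd)
  obtain ⟨d₂, h₂⟩ := hU.exists_condK_condCode_le
    (Computable.fst.pair (hdrop.comp Computable.snd))
  have h (t : Bool) := hU.exists_condK_condCode_le
    (((hadd t).comp Computable.fst).pair Computable.snd)
  have h' (t : Bool) := hU.exists_condK_condCode_le
    (Computable.fst.pair ((hadd t).comp Computable.snd))
  choose e₁ he₁ using h
  choose e₂ he₂ using h'
  refine ⟨d₁ + d₂ + (e₁ true + e₁ false) + (e₂ true + e₂ false), fun x u v t => ?_⟩
  have k₁ := h₁ x (u ++ [t], v)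
  have k₂ := h₂ x (u, v ++ [t])
  have k₃ := he₁ t x (u, v)
  have k₄ := he₂ t x (u, v)
  simp only [List.dropLast_concat] at k₁ k₂
  dsimp only at k₃ k₄
  have b₁ : e₁ t ≤ e₁ true + e₁ false := by cases t <;> simp
  have b₂ : e₂ t ≤ e₂ true + e₂ false := by cases t <;> simp
  simp only [abs_le]
  push_cast
  omega

theorem IsOptimal.exists_condK_le_of_mem_fst (hU : IsOptimal U) :
    ∃ d : ℕ, ∀ p v x : List Bool, x ∈ U p [] → condK U x (condCode (p, v)) ≤ d := by
  obtain ⟨d, hd⟩ := hU.exists_condK_le (V := fun _ y => U (condDecode y).1 [])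
    (hU.1.comp (Computable.fst.comp (computable_condDecode.comp Computable.snd))
      (Computable.const []))
  refine ⟨d, fun p v x h => ?_⟩
  simpa using hd [] (condCode (p, v)) x (by simpa [condDecode_condCode] using h)

theorem IsOptimal.exists_condK_le_of_mem_snd (hU : IsOptimal U) :
    ∃ d : ℕ, ∀ p u x : List Bool, x ∈ U p [] → condK U x (condCode (u, p)) ≤ d := by
  obtain ⟨d, hd⟩ := hU.exists_condK_le (V := fun _ y => U (condDecode y).2 [])
    (hU.1.comp (Computable.snd.comp (computable_condDecode.comp Computable.snd))
      (Computable.const []))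
  refine ⟨d, fun p u x h => ?_⟩
  simpa using hd [] (condCode (u, p)) x (by simpa [condDecode_condCode] using h)

theorem logb_two_natCast_nonneg (n : ℕ) : 0 ≤ Real.logb 2 n := by
  rcases Nat.eq_zero_or_pos n with rfl | h
  · simp
  · exact Real.logb_nonneg one_lt_two (by exact_mod_cast h)

theorem logb_two_natCast_mono {n m : ℕ} (h : n ≤ m) : Real.logb 2 n ≤ Real.logb 2 m := by
  rcases Nat.eq_zero_or_pos n with rfl | h0
  · simpa using logb_two_natCast_nonneg m
  · exact Real.logb_le_logb_of_le one_lt_two (by exact_mod_cast h0) (by exact_mod_cast h)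

/-- A program for `x` under a condition computed from a prefix `u` of a program `u ++ v` for `b`,
together with `u ++ v` and the lengths of `u` and `v`, determines both `x` and `b`. -/
theorem IsOptimal.exists_plainK_le_condK_prefix (hU : IsOptimal U) {g : List Bool → List Bool}
    (hg : Computable g) {f : List Bool → List Bool → List Bool} (hf : Computable₂ f) :
    ∃ D : ℕ, ∀ u v x b : List Bool, b ∈ U (u ++ v) [] →
      (plainK U (f x b) : ℝ) ≤ condK U x (g u) + (u ++ v).length
        + 3 * Real.logb 2 (u ++ v).length + D := by
  have hs : Computable fun s => splitPrefix (splitPrefix s).2 :=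
    computable_splitPrefix.comp (Computable.snd.comp computable_splitPrefix)
  have hu : Computable fun s => (splitPrefix s).1 := Computable.fst.comp computable_splitPrefix
  have hV : Partrec fun s : List Bool =>
      (U (splitPrefix (splitPrefix s).2).2 (g (splitPrefix s).1)).bind fun x =>
        (U ((splitPrefix s).1 ++ (splitPrefix (splitPrefix s).2).1) []).map fun b => f x b := by
    refine (hU.1.comp (Computable.snd.comp hs) (hg.comp hu)).bind ?_
    refine Partrec.map (α := List Bool × List Bool) (hU.1.comp
      (Computable.list_append.comp (hu.comp Computable.fst)
      (Computable.fst.comp (hs.comp Computable.fst))) (Computable.const [])) ?_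
    exact hf.comp (Computable.snd.comp Computable.fst) Computable.snd
  obtain ⟨d, hd⟩ := hU.exists_condK_le (hV.comp Computable.fst).to₂
  refine ⟨d + 8, fun u v x b hb => ?_⟩
  obtain ⟨r, hr, hrl⟩ := hU.exists_shortest x (g u)
  obtain ⟨s₁, hs₁, hl₁⟩ := exists_splitPrefix_eq u
  obtain ⟨s₂, hs₂, hl₂⟩ := exists_splitPrefix_eq v
  have h := hd (s₁ ++ (s₂ ++ r)) [] (f x b) (by
    simp only [hs₁, hs₂, Part.mem_bind_iff, Part.mem_map_iff]
    exact ⟨x, hr, b, hb, rfl⟩)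
  have h' : (plainK U (f x b) : ℝ) ≤ s₁.length + (s₂.length + r.length) + d := by
    simp only [List.length_append] at h
    exact_mod_cast h
  have m₁ := logb_two_natCast_mono (n := u.length) (m := (u ++ v).length) (by simp)
  have m₂ := logb_two_natCast_mono (n := v.length) (m := (u ++ v).length) (by simp)
  have hrl' : (r.length : ℝ) = condK U x (g u) := by exact_mod_cast hrl
  have hlen : ((u ++ v).length : ℝ) = u.length + v.length := by simp
  push_cast
  linarith

/-- The complexity of a pair exceeds the sum of the complexities by at most `3 / 2` times the
logarithm of one of them, up to a constant. The function `f` allows to apply this to the pair in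
either order. -/
theorem IsOptimal.exists_plainK_le_add (hU : IsOptimal U)
    {f : List Bool → List Bool → List Bool} (hf : Computable₂ f) :
    ∃ D : ℕ, ∀ a b : List Bool,
      (plainK U (f a b) : ℝ) ≤ plainK U a + plainK U b
        + 3 / 2 * Real.logb 2 (plainK U a) + D := by
  have hs := computable_splitPrefix
  have hV : Partrec fun s : List Bool =>
      (U (splitPrefix s).1 []).bind fun a => (U (splitPrefix s).2 []).map fun b => f a b := by
    refine (hU.1.comp (Computable.fst.comp hs) (Computable.const [])).bind ?_
    refine Partrec.map (α := List Bool × List Bool) (hU.1.comp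
      (Computable.snd.comp (hs.comp Computable.fst))
      (Computable.const [])) ?_
    exact hf.comp (Computable.snd.comp Computable.fst) Computable.snd
  obtain ⟨d, hd⟩ := hU.exists_condK_le (hV.comp Computable.fst).to₂
  refine ⟨d + 4, fun a b => ?_⟩
  obtain ⟨p, hp, hpl⟩ := hU.exists_shortest a []
  obtain ⟨q, hq, hql⟩ := hU.exists_shortest b []
  obtain ⟨s, hs, hl⟩ := exists_splitPrefix_eq p
  have h := hd (s ++ q) [] (f a b) (by
    simp only [hs, Part.mem_bind_iff, Part.mem_map_iff]
    exact ⟨a, hp, b, hq, rfl⟩)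
  rw [List.length_append] at h
  have h' : (plainK U (f a b) : ℝ) ≤ s.length + q.length + d := by exact_mod_cast h
  rw [hpl] at hl
  rw [hql] at h'
  simp only [plainK] at *
  push_cast
  linarith

/-- The margin bounds the logarithms of both complexities, up to constants. This holds because the
mutual information is at least `-3 / 2` times the smaller of the two logarithms, up to a
constant. -/
theorem IsOptimal.exists_logb_plainK_le_margin (hU : IsOptimal U) :
    ∃ D : ℕ, ∀ a b : List Bool,
      Real.logb 2 (plainK U a) ≤ 2 * (margin U a b + D) ∧
      Real.logb 2 (plainK U b) ≤ 2 * (margin U a b + D) := by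
  obtain ⟨d₁, h₁⟩ := hU.exists_plainK_le_add computable_pairStr
  obtain ⟨d₂, h₂⟩ := hU.exists_plainK_le_add
    (f := fun b a => pairStr a b) (computable_pairStr.comp Computable.snd Computable.fst)
  refine ⟨d₁ + d₂, fun a b => ?_⟩
  have k₁ := h₁ a b
  have k₂ := h₂ b a
  have p₁ := logb_two_natCast_nonneg (plainK U a)
  have p₂ := logb_two_natCast_nonneg (plainK U b)
  have c₁ : (0 : ℝ) ≤ d₁ := Nat.cast_nonneg _
  have c₂ : (0 : ℝ) ≤ d₂ := Nat.cast_nonneg _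
  simp only [margin, mutualInfo]
  push_cast
  constructor <;> linarith

end Complexity

/-! ### The grid of prefixes of shortest programs -/

theorem theorem2 (U : Decompressor) (hU : IsOptimal U) :
    ∃ c : ℕ, ∀ (a b : List Bool) (α β : ℤ),
      0 ≤ α → α ≤ (plainK U a : ℤ) →
      0 ≤ β → β ≤ (plainK U b : ℤ) →
      (c : ℝ) * margin U a b ≤ (α : ℝ) →
      (c : ℝ) * margin U a b ≤ (β : ℝ) →
      (α : ℝ) ≤ (plainK U a : ℝ) - (c : ℝ) * margin U a b →
      (β : ℝ) ≤ (plainK U b : ℝ) - (c : ℝ) * margin U a b →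
      ∃ y : List Bool,
        |(condK U a y : ℤ) - α| ≤ (c : ℤ) ∧ |(condK U b y : ℤ) - β| ≤ (c : ℤ) := by
  obtain ⟨L, hL⟩ := hU.exists_abs_condK_concat_le
  obtain ⟨d₁, hd₁⟩ := hU.exists_condK_le_of_mem_fst
  obtain ⟨d₂, hd₂⟩ := hU.exists_condK_le_of_mem_snd
  obtain ⟨D₁, hD₁⟩ := hU.exists_plainK_le_condK_prefix (g := fun u => condCode ([], u))
    (computable_condCode.comp ((Computable.const []).pair Computable.id)) computable_pairStr
  obtain ⟨D₂, hD₂⟩ := hU.exists_plainK_le_condK_prefix (g := fun u => condCode (u, []))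
    (computable_condCode.comp (Computable.id.pair (Computable.const [])))
    (f := fun b a => pairStr a b) (computable_pairStr.comp Computable.snd Computable.fst)
  obtain ⟨E, hE⟩ := hU.exists_logb_plainK_le_margin
  -- `R` bounds complexities whose logarithm is at most `2 * (1 + E)`.
  obtain ⟨R, hR⟩ : ∃ R, R = 2 ^ (2 * (1 + E)) := ⟨_, rfl⟩
  obtain ⟨c, hc⟩ : ∃ c, c = 2 * L + d₁ + d₂ + D₁ + D₂ + 6 * E + R + 7 := ⟨_, rfl⟩
  have hcL : 2 * L ≤ c := by omega
  have hcd₁ : d₁ < c := by omega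
  have hcd₂ : d₂ < c := by omega
  have hcD₁ : (D₁ : ℝ) + 6 * E + 7 ≤ c := by
    have : D₁ + 6 * E + 7 ≤ c := by omega
    exact_mod_cast this
  have hcD₂ : (D₂ : ℝ) + 6 * E + 7 ≤ c := by
    have : D₂ + 6 * E + 7 ≤ c := by omega
    exact_mod_cast this
  have hcR : R ≤ c := by omega
  clear hc
  refine ⟨c, fun a b α β hα₀ hα₁ hβ₀ hβ₁ hα hβ hα' hβ' => ?_⟩
  obtain ⟨la, lb⟩ := hE a b
  rcases lt_or_ge (margin U a b) 1 with hM | hM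
  · -- A small margin bounds both complexities, so the empty condition will do.
    have bound (n : ℕ) (h : Real.logb 2 n ≤ 2 * (margin U a b + E)) : n ≤ c := by
      rcases Nat.eq_zero_or_pos n with rfl | hn
      · exact Nat.zero_le _
      have h1 : Real.logb 2 n ≤ ((2 * (1 + E) : ℕ) : ℝ) := by push_cast; linarith
      rw [Real.logb_le_iff_le_rpow one_lt_two (by exact_mod_cast hn), Real.rpow_natCast] at h1
      have h2 : n ≤ 2 ^ (2 * (1 + E)) := by exact_mod_cast h1
      exact h2.trans (hR ▸ hcR)
    have ha := bound _ la
    have hb := bound _ lb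
    refine ⟨[], ?_⟩
    simp only [plainK] at *
    simp only [abs_le]
    omega
  obtain ⟨p, hp, hpl⟩ := hU.exists_shortest a []
  obtain ⟨q, hq, hql⟩ := hU.exists_shortest b []
  have pa := logb_two_natCast_nonneg (plainK U a)
  have pb := logb_two_natCast_nonneg (plainK U b)
  have hI : (mutualInfo U a b : ℝ) ≤ margin U a b := by simp only [margin]; linarith
  have hcM : (c : ℝ) ≤ c * margin U a b := le_mul_of_one_le_right (Nat.cast_nonneg _) hM
  have hcα : (c : ℤ) ≤ α := by exact_mod_cast hcM.trans hα
  have hcβ : (c : ℤ) ≤ β := by exact_mod_cast hcM.trans hβ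
  -- The total loss `I(a : b) + 3 * log K + D` on a side of the grid is at most `c` times the margin.
  have slack (D : ℕ) (hD : (D : ℝ) + 6 * E + 7 ≤ c) :
      (mutualInfo U a b : ℝ) + 6 * (margin U a b + E) + D ≤ c * margin U a b := by
    have h1 := mul_le_mul_of_nonneg_right hD (by linarith : 0 ≤ margin U a b)
    have h2 : (0 : ℝ) ≤ (D + 6 * E) * (margin U a b - 1) :=
      mul_nonneg (by positivity) (by linarith)
    linarith
  have htake (l : List Bool) (k : ℕ) (hk : k < l.length) :
      ∃ t, l.take (k + 1) = l.take k ++ [t] := ⟨l[k], by simp⟩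
  obtain ⟨i, -, j, -, hA, hB⟩ := exists_near_of_boundary_signs
    (A := fun i j => (condK U a (condCode (p.take i, q.take j)) : ℤ))
    (B := fun i j => (condK U b (condCode (p.take i, q.take j)) : ℤ))
    (m := p.length) (n := q.length) (α := α) (β := β) (L := L)
    (fun i j hi _ => by obtain ⟨t, ht⟩ := htake p i hi; simpa only [ht] using (hL a _ _ t).1)
    (fun i j _ hj => by obtain ⟨t, ht⟩ := htake q j hj; simpa only [ht] using (hL a _ _ t).2)
    (fun i j hi _ => by obtain ⟨t, ht⟩ := htake p i hi; simpa only [ht] using (hL b _ _ t).1)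
    (fun i j _ hj => by obtain ⟨t, ht⟩ := htake q j hj; simpa only [ht] using (hL b _ _ t).2)
    (fun j _ => by
      -- For `i = 0` the condition knows a prefix of `q` only.
      have h := hD₁ (q.take j) (q.drop j) a b (by rwa [List.take_append_drop])
      rw [List.take_append_drop, hql] at h
      have hs := slack D₁ hcD₁
      simp only [mutualInfo, plainK] at *
      push_cast at hs
      rw [List.take_zero, ← Int.cast_le (R := ℝ)]
      push_cast
      linarith)
    (fun j _ => by
      -- For `i = |p|` the condition contains the whole program `p`.
      have := hd₁ p (q.take j) a hp
      rw [List.take_length]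
      omega)
    (fun i _ => by
      have h := hD₂ (p.take i) (p.drop i) b a (by rwa [List.take_append_drop])
      rw [List.take_append_drop, hpl] at h
      have hs := slack D₂ hcD₂
      simp only [mutualInfo, plainK] at *
      push_cast at hs
      rw [List.take_zero, ← Int.cast_le (R := ℝ)]
      push_cast
      linarith)
    (fun i _ => by
      have := hd₂ q (p.take i) b hq
      rw [List.take_length]
      omega)
  exact ⟨_, hA.trans (by exact_mod_cast hcL), hB.trans (by exact_mod_cast hcL)⟩
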